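/- For $n\ge 0$ let $B_n$ be Artin's braid group on $n$ strands, with generators $\sigma_1,\dots,\sigma_{n-1}$ and relations $\sigma_i\sigma_{i+1}\sigma_i=\sigma_{i+1}\sigma_i\sigma_{i+1}$, and $\sigma_i\sigma_j=\sigma_j\sigma_i$ for $|i-j|\ge 2$. Let $\mathbb F_n$ be the free group on $x_1,\dots,x_n$. The Artin representation is the homomorphism $B_n\to\operatorname{Aut}(\mathbb F_n)$ sending $\sigma_i$ to the automorphism $x_i\mapsto x_ix_{i+1}x_i^{-1}$, $x_{i+1}\mapsto x_i$, $x_k\mapsto x_k$ for $k\ne i,i+1$. An ordering of a group $G$ is a strict total ordering $<$ of its elements such that $x<y$ implies $xz<yz$ and $zx<zy$ for all $x,y,z\in G$. A braid $\beta\in B_n$, acting on $\mathbb F_n$ by the automorphism $\phi$, is called order-preserving if there is some ordering $<$ of $\mathbb F_n$ such that $x<y$ implies $\phi(x)<\phi(y)$ for all $x,y\in\mathbb F_n$. For $\alpha\in B_m$ and $\beta\in B_n$, the tensor product $\alpha\otimes\beta\in B_{m+n}$ is the braid formed by placing $\alpha$ and $\beta$ side by side, with no crossing between the strands of $\alpha$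 and those of $\beta$; that is, $\alpha\otimes\beta=\iota(\alpha)\,\kappa(\beta)$, where $\iota:B_m\to B_{m+n}$ sends $\sigma_i\mapsto\sigma_i$ and $\kappa:B_n\to B_{m+n}$ sends $\sigma_i\mapsto\sigma_{m+i}$. Then, for all $m,n\ge 0$, $\alpha\in B_m$ and $\beta\in B_n$, the braid $\alpha\otimes\beta$ is order-preserving if and only if both $\alpha$ and $\beta$ are order-preserving. -/

import Mathlib

/-- `IsGroupOrder lt`: the relation `lt` is a strict total ordering of the group `G` which is
invariant under multiplication on both sides. -/
structure IsGroupOrder {G : Type*} [Group G] (lt : G → G → Prop) : Prop where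
  strictTotal : IsStrictTotalOrder G lt
  mul_right : ∀ x y z : G, lt x y → lt (x * z) (y * z)
  mul_left : ∀ x y z : G, lt x y → lt (z * x) (z * y)

/-- The defining relations of the braid group on `n` strands, in the free group on
`σ_0, …, σ_{n-2}`: `σ_i σ_{i+1} σ_i = σ_{i+1} σ_i σ_{i+1}`, and `σ_i σ_j = σ_j σ_i` when
`|i - j| ≥ 2`. -/
def braidRels (n : ℕ) : Set (FreeGroup (Fin (n - 1))) :=
  {r | ∃ i j : Fin (n - 1), (i : ℕ) + 1 = j ∧
      r = FreeGroup.of i * FreeGroup.of j * FreeGroup.of i *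
        (FreeGroup.of j * FreeGroup.of i * FreeGroup.of j)⁻¹} ∪
  {r | ∃ i j : Fin (n - 1), (i : ℕ) + 2 ≤ j ∧
      r = FreeGroup.of i * FreeGroup.of j * (FreeGroup.of j * FreeGroup.of i)⁻¹}

/-- Artin's braid group `B_n` on `n` strands (trivial for `n ≤ 1`). -/
abbrev BraidGroup (n : ℕ) : Type := PresentedGroup (braidRels n)

namespace BraidGroup

set_option linter.unusedSimpArgs false

/-- The standard generator `σ_i` of `B_n`, `0 ≤ i ≤ n - 2`: the elementary crossing of the strands
at the positions `i` and `i + 1`. -/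
def σ {n : ℕ} (i : Fin (n - 1)) : BraidGroup n := PresentedGroup.of i

/-- A family of elements satisfying the braid relations defines a homomorphism on `B_n`. -/
theorem lift_rels {n : ℕ} {G : Type*} [Group G] (f : Fin (n - 1) → G)
    (h1 : ∀ i j : Fin (n - 1), (i : ℕ) + 1 = j → f i * f j * f i = f j * f i * f j)
    (h2 : ∀ i j : Fin (n - 1), (i : ℕ) + 2 ≤ j → f i * f j = f j * f i) :
    ∀ r ∈ braidRels n, FreeGroup.lift f r = 1 := by
  rintro r (⟨i, j, hij, rfl⟩ | ⟨i, j, hij, rfl⟩)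
  · rw [map_mul, map_inv, mul_inv_eq_one]
    simpa using h1 i j hij
  · rw [map_mul, map_inv, mul_inv_eq_one]
    simpa using h2 i j hij

theorem σ_braid {n : ℕ} (i j : Fin (n - 1)) (h : (i : ℕ) + 1 = j) :
    (σ i * σ j * σ i : BraidGroup n) = σ j * σ i * σ j :=
  PresentedGroup.mk_eq_mk_of_mul_inv_mem (rels := braidRels n) (Or.inl ⟨i, j, h, rfl⟩)

theorem σ_comm {n : ℕ} (i j : Fin (n - 1)) (h : (i : ℕ) + 2 ≤ j) :
    (σ i * σ j : BraidGroup n) = σ j * σ i :=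
  PresentedGroup.mk_eq_mk_of_mul_inv_mem (rels := braidRels n) (Or.inr ⟨i, j, h, rfl⟩)

/-! ### The Artin representation -/

/-- The position `i` as an index of a free generator. -/
def lo {n : ℕ} (i : Fin (n - 1)) : Fin n := ⟨i, by omega⟩

/-- The position `i + 1` as an index of a free generator. -/
def hi {n : ℕ} (i : Fin (n - 1)) : Fin n := ⟨i + 1, by omega⟩

/-- `x_i ↦ x_i x_{i+1} x_i⁻¹`, `x_{i+1} ↦ x_i`, and `x_k ↦ x_k` for `k ≠ i, i + 1`. -/
def artinFun {n : ℕ} (i : Fin (n - 1)) (k : Fin n) : FreeGroup (Fin n) :=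
  if k = lo i then FreeGroup.of (lo i) * FreeGroup.of (hi i) * (FreeGroup.of (lo i))⁻¹
  else if k = hi i then FreeGroup.of (lo i)
  else FreeGroup.of k

/-- `x_i ↦ x_{i+1}`, `x_{i+1} ↦ x_{i+1}⁻¹ x_i x_{i+1}`, and `x_k ↦ x_k` for `k ≠ i, i + 1`. -/
def artinInvFun {n : ℕ} (i : Fin (n - 1)) (k : Fin n) : FreeGroup (Fin n) :=
  if k = lo i then FreeGroup.of (hi i)
  else if k = hi i then (FreeGroup.of (hi i))⁻¹ * FreeGroup.of (lo i) * FreeGroup.of (hi i)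
  else FreeGroup.of k

theorem hi_ne_lo {n : ℕ} (i : Fin (n - 1)) : hi i ≠ lo i := by
  simp [hi, lo, Fin.ext_iff]

/-- The automorphism of the free group `𝔽_n` corresponding to the generator `σ_i`. -/
def artinGen {n : ℕ} (i : Fin (n - 1)) : MulAut (FreeGroup (Fin n)) :=
  MonoidHom.toMulEquiv (FreeGroup.lift (artinFun i)) (FreeGroup.lift (artinInvFun i))
    (by
      ext k
      by_cases h1 : k = lo i
      · simp [artinFun, artinInvFun, h1, hi_ne_lo, mul_assoc]
      · by_cases h2 : k = hi i
        · simp [artinFun, artinInvFun, h2, hi_ne_lo]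
        · simp [artinFun, artinInvFun, h1, h2])
    (by
      ext k
      by_cases h1 : k = lo i
      · simp [artinFun, artinInvFun, h1, hi_ne_lo]
      · by_cases h2 : k = hi i
        · simp [artinFun, artinInvFun, h2, hi_ne_lo, mul_assoc]
        · simp [artinFun, artinInvFun, h1, h2])

theorem artinGen_of {n : ℕ} (i : Fin (n - 1)) (k : Fin n) :
    artinGen i (FreeGroup.of k) = artinFun i k := by
  simp [artinGen]

theorem mulAut_ext {n : ℕ} {φ ψ : MulAut (FreeGroup (Fin n))}
    (h : ∀ k, φ (FreeGroup.of k) = ψ (FreeGroup.of k)) : φ = ψ :=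
  MulEquiv.toMonoidHom_injective (FreeGroup.ext_hom _ _ h)

theorem artinGen_braid {n : ℕ} (i j : Fin (n - 1)) (h : (i : ℕ) + 1 = j) :
    artinGen i * artinGen j * artinGen i = artinGen j * artinGen i * artinGen j := by
  have e : lo j = hi i := by simp [lo, hi, Fin.ext_iff, h]
  have a := hi_ne_lo i
  have b : hi j ≠ hi i := by rw [← e]; exact hi_ne_lo j
  have c : hi j ≠ lo i := by simp [lo, hi, Fin.ext_iff]; omega
  refine mulAut_ext fun k => ?_
  simp only [MulAut.mul_apply, artinGen_of]
  by_cases h1 : k = lo i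
  · subst h1
    simp [artinFun, e, a, b, c, a.symm, b.symm, c.symm, artinGen_of, mul_assoc]
  · by_cases h2 : k = hi i
    · subst h2
      simp [artinFun, e, a, b, c, a.symm, b.symm, c.symm, artinGen_of, mul_assoc]
    · by_cases h3 : k = hi j
      · subst h3
        simp [artinFun, e, a, b, c, a.symm, b.symm, c.symm, artinGen_of]
      · simp [artinFun, e, h1, h2, h3, artinGen_of]

theorem artinGen_comm {n : ℕ} (i j : Fin (n - 1)) (h : (i : ℕ) + 2 ≤ j) :
    artinGen i * artinGen j = artinGen j * artinGen i := by
  have a := hi_ne_lo i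
  have a' := hi_ne_lo j
  have b : lo j ≠ lo i := by simp [lo, Fin.ext_iff]; omega
  have c : lo j ≠ hi i := by simp [lo, hi, Fin.ext_iff]; omega
  have d : hi j ≠ lo i := by simp [lo, hi, Fin.ext_iff]; omega
  have e : hi j ≠ hi i := by simp [hi, Fin.ext_iff]; omega
  refine mulAut_ext fun k => ?_
  simp only [MulAut.mul_apply, artinGen_of]
  by_cases h1 : k = lo i
  · subst h1
    simp [artinFun, a, b, c, d, e, a.symm, b.symm, c.symm, d.symm, e.symm, artinGen_of]
  · by_cases h2 : k = hi i
    · subst h2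
      simp [artinFun, a, b, c, d, e, a.symm, b.symm, c.symm, d.symm, e.symm, artinGen_of]
    · by_cases h3 : k = lo j
      · subst h3
        simp [artinFun, a', b, c, d, e, artinGen_of]
      · by_cases h4 : k = hi j
        · subst h4
          simp [artinFun, a', b, c, d, e, artinGen_of]
        · simp [artinFun, h1, h2, h3, h4, artinGen_of]

/-- The Artin representation `B_n → Aut(𝔽_n)`. -/
def artin (n : ℕ) : BraidGroup n →* MulAut (FreeGroup (Fin n)) :=
  PresentedGroup.toGroup (lift_rels artinGen artinGen_braid artinGen_comm)

/-! ### The tensor product of braids -/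

/-- `B_m → B_{m+n}`, `σ_i ↦ σ_i`: add `n` straight strands on the right. -/
def inclLeft (m n : ℕ) : BraidGroup m →* BraidGroup (m + n) :=
  PresentedGroup.toGroup
    (lift_rels (fun i => (σ ⟨i, by omega⟩ : BraidGroup (m + n)))
      (fun _ _ h => σ_braid _ _ h) (fun _ _ h => σ_comm _ _ h))

/-- `B_n → B_{m+n}`, `σ_i ↦ σ_{m+i}`: add `m` straight strands on the left. -/
def inclRight (m n : ℕ) : BraidGroup n →* BraidGroup (m + n) :=
  PresentedGroup.toGroup
    (lift_rels (fun i => (σ ⟨m + i, by omega⟩ : BraidGroup (m + n)))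
      (fun _ _ h => σ_braid _ _ (by simp only; omega))
      (fun _ _ h => σ_comm _ _ (by simp only; omega)))

/-- The tensor product `α ⊗ β ∈ B_{m+n}`: the braid `α` on the first `m` strands placed side by side
with the braid `β` on the last `n` strands, with no crossings between the two groups of strands. -/
def tensor {m n : ℕ} (α : BraidGroup m) (β : BraidGroup n) : BraidGroup (m + n) :=
  inclLeft m n α * inclRight m n β

/-- A braid is order-preserving if its image under the Artin representation preserves some
(bi-invariant, strict, total) ordering of the free group. -/
def OrderPreserving {n : ℕ} (β : BraidGroup n) : Prop :=
  ∃ lt : FreeGroup (Fin n) → FreeGroup (Fin n) → Prop,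
    IsGroupOrder lt ∧ ∀ x y, lt x y → lt (artin n β x) (artin n β y)

end BraidGroup

/-! The braid `tensor α β` acts on the free product `𝔽_m * 𝔽_n = 𝔽_{m+n}` through the Artin actions
of `α` and `β` on the factors. An invariant ordering therefore restricts to each factor
(`OrderPreserving.of_map`). The converse needs an ordering of a free product that is natural in the
ordered factors (`exists_isGroupOrder`).

Let `P` be the product of the factors, ordered lexicographically. The free product is represented by
infinite upper triangular matrices over `ℤ[P]`: an element `g` of a factor becomes a block diagonal
matrix with blocks `!![1, g - 1; 0, g]`, and the blocks of the two factors are staggered by one row.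
A reduced word of length `L` has on the `L`-th superdiagonal an entry that is a product of factors
`g - 1` and units, nonzero because `ℤ[P]` is a domain; so the representation is faithful
(`triangularRep_injective`).

Call a matrix positive if its first nonzero entry, diagonal by diagonal, has positive coefficient at
the least element of its support. Multiplication by matrices with group elements on the diagonal
preserves positivity, so positivity of differences orders the group (`isGroupOrder_of_injective`).
Order-preserving automorphisms of the factors act entrywise through `P`, which also preserves
positivity. -/

/-! ### Positivity by leading value. -/

/-- The first nonzero value of `f` exists and satisfies `pos`. -/
def LeadPos {ι M : Type*} [LT ι] [Zero M] (pos : M → Prop) (f : ι → M) : Prop :=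
  ∃ i, pos (f i) ∧ ∀ j < i, f j = 0

namespace LeadPos

variable {ι M : Type*} [LinearOrder ι] {pos : M → Prop}

theorem ne_zero [Zero M] (h0 : ¬ pos 0) {f : ι → M} (hf : LeadPos pos f) : f ≠ 0 := by
  rintro rfl
  obtain ⟨i, hi, -⟩ := hf
  exact h0 hi

theorem add [AddZeroClass M] (hadd : ∀ x y, pos x → pos y → pos (x + y)) {f g : ι → M}
    (hf : LeadPos pos f) (hg : LeadPos pos g) : LeadPos pos (f + g) := by
  obtain ⟨i, hi, hi'⟩ := hf
  obtain ⟨j, hj, hj'⟩ := hg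
  rcases lt_trichotomy i j with h | rfl | h
  · exact ⟨i, by simpa [hj' i h] using hi, fun k hk => by simp [hi' k hk, hj' k (hk.trans h)]⟩
  · exact ⟨i, hadd _ _ hi hj, fun k hk => by simp [hi' k hk, hj' k hk]⟩
  · exact ⟨j, by simpa [hi' j h] using hj, fun k hk => by simp [hj' k hk, hi' k (hk.trans h)]⟩

/-- The existence of a first nonzero value is a hypothesis because it has two sources: finite
support in a group ring, well-foundedness of `ℕ ×ₗ ℕ` for matrices. -/
theorem trichotomy [AddGroup M] (htri : ∀ x, x = 0 ∨ pos x ∨ pos (-x)) {f : ι → M}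
    (hf : f ≠ 0 → ∃ i, f i ≠ 0 ∧ ∀ j < i, f j = 0) :
    f = 0 ∨ LeadPos pos f ∨ LeadPos pos (-f) := by
  by_cases h : f = 0
  · exact .inl h
  obtain ⟨i, hi, hi'⟩ := hf h
  rcases htri (f i) with h0 | h0 | h0
  · exact absurd h0 hi
  · exact .inr (.inl ⟨i, h0, hi'⟩)
  · exact .inr (.inr ⟨i, h0, fun j hj => by simp [hi' j hj]⟩)

end LeadPos

/-! ### Positivity in the group ring of an ordered group. -/

namespace MonoidAlgebra

/-- Positivity in the group ring of an ordered group: the coefficient of the least element of the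
support is positive. -/
def IsPos {P : Type*} [LT P] (r : MonoidAlgebra ℤ P) : Prop :=
  LeadPos (fun k : ℤ => 0 < k) (r.coeff : P → ℤ)

section

variable {P : Type*} [LinearOrder P]

theorem IsPos.ne_zero {r : MonoidAlgebra ℤ P} (hr : r.IsPos) : r ≠ 0 := by
  rintro rfl
  exact LeadPos.ne_zero (by simp) hr (by simp)

theorem IsPos.add {r s : MonoidAlgebra ℤ P} (hr : r.IsPos) (hs : s.IsPos) : (r + s).IsPos := by
  simpa [IsPos] using LeadPos.add (fun _ _ => add_pos) hr hs

theorem isPos_trichotomy (r : MonoidAlgebra ℤ P) : r = 0 ∨ r.IsPos ∨ (-r).IsPos := by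
  have := LeadPos.trichotomy (pos := fun k : ℤ => 0 < k) (f := (r.coeff : P → ℤ))
    (fun x => by rcases lt_trichotomy x 0 with h | h | h <;> simp [h]) (fun h => by
      have hne : r.coeff.support.Nonempty := by
        rw [Finsupp.support_nonempty_iff]
        rintro h0
        exact h (by simp [h0])
      refine ⟨r.coeff.support.min' hne, Finsupp.mem_support_iff.1 (Finset.min'_mem _ _), ?_⟩
      intro j hj
      by_contra h0
      exact absurd (Finset.min'_le _ j (Finsupp.mem_support_iff.2 h0)) (not_le.2 hj))
  rcases this with h | h | h
  · left
    rw [← coeff_eq_zero]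
    exact DFunLike.coe_injective h
  · exact .inr (.inl h)
  · exact .inr (.inr (by simpa [IsPos] using h))

theorem IsPos.mapDomain {Q : Type*} [LinearOrder Q] {e : P ≃ Q} (he : StrictMono e)
    {r : MonoidAlgebra ℤ P} (hr : r.IsPos) : (mapDomain e r).IsPos := by
  obtain ⟨p, hp, hp'⟩ := hr
  have key (x : P) : (MonoidAlgebra.mapDomain e r).coeff (e x) = r.coeff x := by
    simp [MonoidAlgebra.mapDomain, Finsupp.mapDomain_apply e.injective]
  refine ⟨e p, by simpa [key] using hp, fun q hq => ?_⟩
  obtain ⟨x, rfl⟩ := e.surjective q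
  rw [key]
  exact hp' x (he.lt_iff_lt.1 hq)

variable [Group P]

theorem IsPos.single_mul [MulLeftStrictMono P] {r : MonoidAlgebra ℤ P} (hr : r.IsPos) (g : P) :
    (single g 1 * r).IsPos := by
  obtain ⟨p, hp, hp'⟩ := hr
  refine ⟨g * p, by simpa using hp, fun q hq => ?_⟩
  simpa using hp' (g⁻¹ * q) (by simpa using mul_lt_mul_right hq g⁻¹)

theorem IsPos.mul_single [MulRightStrictMono P] {r : MonoidAlgebra ℤ P} (hr : r.IsPos) (g : P) :
    (r * single g 1).IsPos := by
  obtain ⟨p, hp, hp'⟩ := hr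
  refine ⟨p * g, by simpa using hp, fun q hq => ?_⟩
  simpa using hp' (q * g⁻¹) (by simpa using mul_lt_mul_left hq g⁻¹)

end

end MonoidAlgebra

/-! ### Positivity of upper triangular matrices over the group ring. -/

namespace IncidenceAlgebra

open MonoidAlgebra Finset

variable {P : Type*}

/-- The entries of an upper triangular matrix, diagonal by diagonal. -/
def diagonals {R : Type*} [Zero R] (D : IncidenceAlgebra R ℕ) (x : ℕ ×ₗ ℕ) : R :=
  D (ofLex x).2 ((ofLex x).2 + (ofLex x).1)

/-- Positivity of an upper triangular matrix over a group ring: the first nonzero entry is positive,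
where the matrix is read diagonal by diagonal, starting with the main diagonal. -/
def IsPos [LT P] (D : IncidenceAlgebra (MonoidAlgebra ℤ P) ℕ) : Prop :=
  LeadPos MonoidAlgebra.IsPos D.diagonals

theorem diagonals_eq_zero {R : Type*} [Zero R] {D : IncidenceAlgebra R ℕ} (h : D.diagonals = 0) :
    D = 0 := by
  ext a b hab
  have := congrFun h (toLex (b - a, a))
  simpa [diagonals, Nat.add_sub_cancel' hab] using this

section

variable [LinearOrder P]

theorem IsPos.ne_zero {D : IncidenceAlgebra (MonoidAlgebra ℤ P) ℕ} (hD : D.IsPos) : D ≠ 0 := by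
  rintro rfl
  exact LeadPos.ne_zero (fun h => h.ne_zero rfl) hD rfl

theorem IsPos.add {D E : IncidenceAlgebra (MonoidAlgebra ℤ P) ℕ} (hD : D.IsPos) (hE : E.IsPos) :
    (D + E).IsPos :=
  LeadPos.add (pos := MonoidAlgebra.IsPos) (fun _ _ h1 h2 => h1.add h2) hD hE

theorem isPos_trichotomy (D : IncidenceAlgebra (MonoidAlgebra ℤ P) ℕ) :
    D = 0 ∨ D.IsPos ∨ (-D).IsPos := by
  have := LeadPos.trichotomy (pos := MonoidAlgebra.IsPos (P := P)) (f := D.diagonals)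
    MonoidAlgebra.isPos_trichotomy (fun h => by
      have hne : {i | D.diagonals i ≠ 0}.Nonempty := Function.ne_iff.1 h
      refine ⟨wellFounded_lt.min _ hne, wellFounded_lt.min_mem _ hne, fun j hj => ?_⟩
      by_contra h0
      exact wellFounded_lt.not_lt_min _ h0 hj)
  exact this.imp_left diagonals_eq_zero

end

/-- The diagonal entries of an upper triangular matrix over a group ring are group elements. -/
def HasGroupDiag [Group P] (M : IncidenceAlgebra (MonoidAlgebra ℤ P) ℕ) : Prop :=
  ∀ a, ∃ p, M a a = single p 1

variable [Group P]

theorem HasGroupDiag.one : HasGroupDiag (1 : IncidenceAlgebra (MonoidAlgebra ℤ P) ℕ) :=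
  fun _ => ⟨1, by simp [MonoidAlgebra.one_def]⟩

theorem HasGroupDiag.mul {M N : IncidenceAlgebra (MonoidAlgebra ℤ P) ℕ} (hM : M.HasGroupDiag)
    (hN : N.HasGroupDiag) : (M * N).HasGroupDiag := fun a => by
  obtain ⟨p, hp⟩ := hM a
  obtain ⟨q, hq⟩ := hN a
  exact ⟨p * q, by simp [hp, hq]⟩

variable [LinearOrder P]

/-- Up to the leading position only the diagonal of `M` contributes, so the leading entry stays in
place and is multiplied by a group element. -/
theorem IsPos.mul_left [MulLeftStrictMono P] {D M : IncidenceAlgebra (MonoidAlgebra ℤ P) ℕ}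
    (hD : D.IsPos) (hM : M.HasGroupDiag) : (M * D).IsPos := by
  obtain ⟨⟨d, a⟩, hp, hz⟩ := hD
  have hz' : ∀ d' a', d' < d ∨ d' = d ∧ a' < a → D a' (a' + d') = 0 := fun d' a' h =>
    hz (toLex (d', a')) (Prod.Lex.toLex_lt_toLex (x := (d', a')) (y := (d, a)) |>.2 h)
  -- A term of the product with `x > a'` involves an entry of `D` on a diagonal below `d'`, hence
  -- below `d`, where `D` vanishes.
  have key : ∀ d' a', (d' < d ∨ d' = d ∧ a' ≤ a) →
      (M * D) a' (a' + d') = M a' a' * D a' (a' + d') := fun d' a' h => by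
    rw [mul_apply]
    refine sum_eq_single_of_mem _ (by simp) fun x hx hne => ?_
    obtain ⟨h1, h2⟩ := mem_Icc.1 hx
    have := hz' (a' + d' - x) x (by omega)
    rw [Nat.add_sub_cancel' h2] at this
    simp [this]
  refine ⟨toLex (d, a), ?_, fun x hx => ?_⟩
  · obtain ⟨p, hp'⟩ := hM a
    change ((M * D) a (a + d)).IsPos
    rw [key d a (.inr ⟨rfl, le_rfl⟩), hp']
    exact MonoidAlgebra.IsPos.single_mul hp p
  · obtain ⟨d', a'⟩ := x
    have h := Prod.Lex.toLex_lt_toLex.1 hx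
    change (M * D) a' (a' + d') = 0
    rw [key d' a' (h.imp_right fun h => ⟨h.1, h.2.le⟩), hz' d' a' h, mul_zero]

theorem IsPos.mul_right [MulRightStrictMono P] {D M : IncidenceAlgebra (MonoidAlgebra ℤ P) ℕ}
    (hD : D.IsPos) (hM : M.HasGroupDiag) : (D * M).IsPos := by
  obtain ⟨⟨d, a⟩, hp, hz⟩ := hD
  have hz' : ∀ d' a', d' < d ∨ d' = d ∧ a' < a → D a' (a' + d') = 0 := fun d' a' h =>
    hz (toLex (d', a')) (Prod.Lex.toLex_lt_toLex (x := (d', a')) (y := (d, a)) |>.2 h)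
  have key : ∀ d' a', (d' < d ∨ d' = d ∧ a' ≤ a) →
      (D * M) a' (a' + d') = D a' (a' + d') * M (a' + d') (a' + d') := fun d' a' h => by
    rw [mul_apply]
    refine sum_eq_single_of_mem _ (by simp) fun x hx hne => ?_
    obtain ⟨h1, h2⟩ := mem_Icc.1 hx
    have := hz' (x - a') a' (by omega)
    rw [Nat.add_sub_cancel' h1] at this
    simp [this]
  refine ⟨toLex (d, a), ?_, fun x hx => ?_⟩
  · obtain ⟨p, hp'⟩ := hM (a + d)
    change ((D * M) a (a + d)).IsPos
    rw [key d a (.inr ⟨rfl, le_rfl⟩), hp']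
    exact MonoidAlgebra.IsPos.mul_single hp p
  · obtain ⟨d', a'⟩ := x
    have h := Prod.Lex.toLex_lt_toLex.1 hx
    change (D * M) a' (a' + d') = 0
    rw [key d' a' (h.imp_right fun h => ⟨h.1, h.2.le⟩), hz' d' a' h, zero_mul]

/-- A group which embeds into the upper triangular matrices over the group ring of an ordered group,
with group elements on the diagonal, is ordered by the positivity of differences. -/
theorem isGroupOrder_of_injective [MulLeftStrictMono P] [MulRightStrictMono P] {K : Type*} [Group K]
    (ρ : K →* IncidenceAlgebra (MonoidAlgebra ℤ P) ℕ) (hρ : Function.Injective ρ)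
    (hdiag : ∀ x, (ρ x).HasGroupDiag) : IsGroupOrder fun x y => (ρ y - ρ x).IsPos where
  strictTotal :=
    { irrefl := fun x h => h.ne_zero (sub_self _)
      trans := fun x y z h1 h2 => by simpa using h2.add h1
      trichotomous := fun x y h1 h2 => by
        rcases isPos_trichotomy (ρ y - ρ x) with h | h | h
        · exact (hρ (sub_eq_zero.1 h)).symm
        · exact absurd h h1
        · exact absurd (by simpa using h) h2 }
  mul_right x y z h := by simpa [sub_mul] using h.mul_right (hdiag z)
  mul_left x y z h := by simpa [mul_sub] using h.mul_left (hdiag z)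

end IncidenceAlgebra

/-! ### Faithful triangular representation of a free product of two groups. -/

namespace Monoid.CoprodI

open MonoidAlgebra IncidenceAlgebra Finset

variable {P : Type*} [Group P]

/-- The block diagonal matrix with the blocks `!![1, g - 1; 0, g]` in the rows and columns `a`,
`a + 1`, for all `a` of parity `b`. -/
noncomputable def blockMatrix (b : Bool) (g : P) : IncidenceAlgebra (MonoidAlgebra ℤ P) ℕ where
  toFun x y :=
    if x = y then (if x.bodd = b then 1 else single g 1)
    else if x + 1 = y ∧ x.bodd = b then single g 1 - 1 else 0
  eq_zero_of_not_le' x y h := by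
    rw [if_neg (by omega), if_neg (by omega)]

theorem blockMatrix_apply (b : Bool) (g : P) (x y : ℕ) :
    blockMatrix b g x y = if x = y then (if x.bodd = b then 1 else single g 1)
      else if x + 1 = y ∧ x.bodd = b then single g 1 - 1 else 0 := rfl

/-- The homomorphism `g ↦ !![1, g - 1; 0, g]` to block diagonal matrices. -/
noncomputable def blockHom (b : Bool) : P →* IncidenceAlgebra (MonoidAlgebra ℤ P) ℕ where
  toFun := blockMatrix b
  map_one' := by
    ext x y -
    simp [blockMatrix_apply, ← MonoidAlgebra.one_def]
  map_mul' g h := by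
    ext x y hxy : 3
    rcases hxy.eq_or_lt with rfl | hlt
    · by_cases hb : x.bodd = b <;> simp [blockMatrix_apply, hb]
    · have hsub : ({x, x + 1} : Finset ℕ) ⊆ Icc x y := by
        intro z hz
        simp only [mem_insert, mem_singleton] at hz
        simp only [mem_Icc]
        omega
      -- Row `x` of a block matrix is supported in the columns `x` and `x + 1`.
      rw [IncidenceAlgebra.mul_apply, ← sum_subset hsub]
      · rw [sum_pair (by omega)]
        simp only [blockMatrix_apply]
        by_cases hb : x.bodd = b
        · by_cases hy : x + 1 = y
          · subst hy
            -- `1 * (h - 1) + (g - 1) * h = g * h - 1`.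
            simp [hb, sub_mul]
          · simp [hb, hy, hlt.ne]
        · simp [hb, hlt.ne]
      · intro z hz hz'
        simp only [mem_insert, mem_singleton, not_or] at hz'
        rw [blockMatrix_apply, if_neg (Ne.symm hz'.1), if_neg (by omega), zero_mul]

variable {G : Bool → Type*} [∀ b, Group (G b)] (f : ∀ b, G b →* P)

/-- The representation of a free product of two groups by upper triangular matrices over the group
ring of a group to which both factors map. -/
noncomputable def triangularRep : CoprodI G →* IncidenceAlgebra (MonoidAlgebra ℤ P) ℕ :=
  lift fun b => (blockHom b).comp (f b)

theorem triangularRep_of (b : Bool) (g : G b) : triangularRep f (of g) = blockMatrix b (f b g) := by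
  simp [triangularRep, blockHom]

theorem hasGroupDiag_triangularRep (x : CoprodI G) : (triangularRep f x).HasGroupDiag := by
  induction x using CoprodI.induction_on with
  | one => simpa using HasGroupDiag.one
  | of b g =>
    intro a
    rw [triangularRep_of, blockMatrix_apply, if_pos rfl]
    split_ifs
    · exact ⟨1, MonoidAlgebra.one_def⟩
    · exact ⟨_, rfl⟩
  | mul x y hx hy => simpa using hx.mul hy

/-- Naturality of the matrix representation. -/
theorem triangularRep_lift (φ : ∀ b, G b →* G b) (θ : P →* P)
    (h : ∀ b g, f b (φ b g) = θ (f b g)) (x : CoprodI G) (a c : ℕ) :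
    triangularRep f (lift (fun b => of.comp (φ b)) x) a c =
      mapDomainRingHom ℤ θ (triangularRep f x a c) := by
  induction x using CoprodI.induction_on generalizing a c with
  | one => by_cases hac : a = c <;> simp [hac]
  | of b g =>
    simp only [lift_of, MonoidHom.comp_apply, triangularRep_of, blockMatrix_apply, h]
    split_ifs <;> simp only [map_sub, map_one, map_zero, mapDomainRingHom_apply, mapDomain_single]
  | mul x y hx hy =>
    simp only [map_mul, IncidenceAlgebra.mul_apply, map_sum, hx, hy]

/-- `L` is the syllable length. Each syllable moves at most one column to the right, and its step
entry `g - 1` occurs only in rows of the parity of its factor; the alternation of factors in a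
reduced word matches the alternation of parities. -/
theorem exists_band_of_neWord [NoZeroDivisors (MonoidAlgebra ℤ P)]
    (hf : ∀ b, Function.Injective (f b)) {i j : Bool} (w : NeWord G i j) :
    ∃ L : ℕ, 0 < L ∧ (∀ a c, a + L < c → triangularRep f w.prod a c = 0) ∧
      ∀ a, a.bodd = i → (a + L).bodd = !j ∧ triangularRep f w.prod a (a + L) ≠ 0 := by
  induction w with
  | @singleton i x hx =>
    refine ⟨1, one_pos, fun a c hac => ?_, fun a ha => ⟨by simp [ha], ?_⟩⟩
    · rw [NeWord.prod_singleton, triangularRep_of, blockMatrix_apply, if_neg (by omega),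
        if_neg (by omega)]
    · rw [NeWord.prod_singleton, triangularRep_of, blockMatrix_apply, if_neg (by omega),
        if_pos ⟨rfl, ha⟩, sub_ne_zero, MonoidAlgebra.one_def]
      intro h
      refine hx (hf i ?_)
      rw [map_one]
      exact single_left_injective one_ne_zero h
  | @append i j k l w₁ hne w₂ ih₁ ih₂ =>
    obtain ⟨L₁, hL₁, hz₁, hn₁⟩ := ih₁
    obtain ⟨L₂, hL₂, hz₂, hn₂⟩ := ih₂
    refine ⟨L₁ + L₂, by omega, fun a c hac => ?_, fun a ha => ?_⟩
    · rw [NeWord.append_prod, map_mul, IncidenceAlgebra.mul_apply]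
      refine sum_eq_zero fun x _ => ?_
      by_cases hx : a + L₁ < x
      · rw [hz₁ a x hx, zero_mul]
      · rw [hz₂ x c (by omega), mul_zero]
    · obtain ⟨hb, h1⟩ := hn₁ a ha
      -- Adjacent syllables lie in different factors, so `w₂` starts in a row of its own parity.
      have hk : (!j) = k := by cases j <;> cases k <;> simp_all
      obtain ⟨hb', h2⟩ := hn₂ (a + L₁) (hb.trans hk)
      rw [← add_assoc]
      refine ⟨hb', ?_⟩
      rw [NeWord.append_prod, map_mul, IncidenceAlgebra.mul_apply,
        -- Both bands must be used to full width, which leaves `a + L₁` as the only intermediate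
        -- index.
        sum_eq_single_of_mem (a + L₁) (by simp)]
      · exact mul_ne_zero h1 h2
      · intro x hx hne'
        by_cases hx' : a + L₁ < x
        · rw [hz₁ a x hx', zero_mul]
        · rw [hz₂ x _ (by omega), mul_zero]

theorem triangularRep_injective [NoZeroDivisors (MonoidAlgebra ℤ P)]
    (hf : ∀ b, Function.Injective (f b)) : Function.Injective (triangularRep f) := by
  classical
  rw [injective_iff_map_eq_one]
  intro x hx
  by_contra hne
  obtain ⟨i, j, w, hw⟩ := NeWord.of_word (Word.equiv x) (fun h => hne (by
    rw [← Word.equiv.symm_apply_apply x, h]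
    exact Word.prod_empty))
  obtain ⟨L, hL, -, hn⟩ := exists_band_of_neWord f hf w
  have hwx : w.prod = x := by
    rw [NeWord.prod, hw]
    exact Word.equiv.symm_apply_apply x
  obtain ⟨a, ha⟩ : ∃ a : ℕ, a.bodd = i := by
    cases i
    · exact ⟨0, rfl⟩
    · exact ⟨1, rfl⟩
  refine (hn a ha).2 ?_
  rw [hwx, hx, IncidenceAlgebra.one_apply, if_neg (by omega)]

end Monoid.CoprodI

/-! ### Orderings of products, subgroups and free products. -/

/-- A strict total ordering relation as a linear order. -/
noncomputable abbrev IsGroupOrder.toLinearOrder {G : Type*} [Group G] {lt : G → G → Prop}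
    (h : IsGroupOrder lt) : LinearOrder G :=
  letI := h.strictTotal
  @linearOrderOfSTO G lt _ (Classical.decRel _)

/-- A product of ordered groups is ordered lexicographically. -/
theorem IsGroupOrder.pi {ι : Type*} [LinearOrder ι] [WellFoundedLT ι] {G : ι → Type*}
    [∀ i, Group (G i)] {lt : ∀ i, G i → G i → Prop} (h : ∀ i, IsGroupOrder (lt i)) :
    IsGroupOrder (Pi.Lex (· < ·) fun {i} => lt i) := by
  let : ∀ i, LinearOrder (G i) := fun i => (h i).toLinearOrder
  refine ⟨?_, ?_, ?_⟩
  · exact (inferInstance : IsStrictTotalOrder (Lex (∀ i, G i)) (· < ·))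
  · rintro x y z ⟨i, hi, hi'⟩
    exact ⟨i, fun j hj => by simp [hi j hj], (h i).mul_right _ _ _ hi'⟩
  · rintro x y z ⟨i, hi, hi'⟩
    exact ⟨i, fun j hj => by simp [hi j hj], (h i).mul_left _ _ _ hi'⟩

theorem IsGroupOrder.comap {G H : Type*} [Group G] [Group H] {lt : H → H → Prop}
    (h : IsGroupOrder lt) (f : G →* H) (hf : Function.Injective f) :
    IsGroupOrder fun x y => lt (f x) (f y) where
  strictTotal :=
    { irrefl := fun x => h.strictTotal.irrefl (f x)
      trans := fun x y z => h.strictTotal.trans (f x) (f y) (f z)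
      trichotomous := fun x y h1 h2 => hf (h.strictTotal.trichotomous _ _ h1 h2) }
  mul_right x y z hxy := by simpa using h.mul_right _ _ (f z) hxy
  mul_left x y z hxy := by simpa using h.mul_left _ _ (f z) hxy

namespace Monoid.CoprodI

open MonoidAlgebra IncidenceAlgebra

variable {G : Bool → Type*} [∀ b, Group (G b)]

theorem exists_isGroupOrder_of_ambient {P : Type*} [Group P] {ltP : P → P → Prop}
    (hP : IsGroupOrder ltP) (f : ∀ b, G b →* P) (hf : ∀ b, Function.Injective (f b))
    (φ : ∀ b, G b →* G b) (θ : P ≃* P) (hθ : ∀ x y, ltP x y → ltP (θ x) (θ y))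
    (h : ∀ b g, f b (φ b g) = θ (f b g)) :
    ∃ lt : CoprodI G → CoprodI G → Prop, IsGroupOrder lt ∧
      ∀ x y, lt x y → lt (lift (fun b => of.comp (φ b)) x) (lift (fun b => of.comp (φ b)) y) := by
  let : LinearOrder P := hP.toLinearOrder
  -- Invariance of the order also makes `ℤ[P]` a domain, as faithfulness requires.
  have : MulLeftStrictMono P := ⟨fun z x y => hP.mul_left x y z⟩
  have : MulRightStrictMono P := ⟨fun z x y => hP.mul_right x y z⟩
  refine ⟨_, isGroupOrder_of_injective (triangularRep f) (triangularRep_injective f hf)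
    (hasGroupDiag_triangularRep f), ?_⟩
  rintro x y ⟨i, hi, hz⟩
  -- The automorphism acts on matrices entry by entry through `θ`, so leading positions do not move.
  have key (i : ℕ ×ₗ ℕ) : (triangularRep f (lift (fun b => of.comp (φ b)) y) -
      triangularRep f (lift (fun b => of.comp (φ b)) x)).diagonals i =
      mapDomainRingHom ℤ θ.toMonoidHom ((triangularRep f y - triangularRep f x).diagonals i) := by
    simp only [diagonals, IncidenceAlgebra.sub_apply, map_sub]
    rw [triangularRep_lift f φ θ.toMonoidHom h, triangularRep_lift f φ θ.toMonoidHom h]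
  refine ⟨i, ?_, fun j hj => ?_⟩
  · rw [key]
    exact MonoidAlgebra.IsPos.mapDomain (e := θ.toEquiv) hθ hi
  · rw [key, hz j hj, map_zero]

/-- Automorphisms of two groups, each preserving an ordering, together preserve an ordering of the
free product. -/
theorem exists_isGroupOrder {lt : ∀ b, G b → G b → Prop} (hlt : ∀ b, IsGroupOrder (lt b))
    (φ : ∀ b, MulAut (G b)) (hφ : ∀ b x y, lt b x y → lt b (φ b x) (φ b y)) :
    ∃ lt : CoprodI G → CoprodI G → Prop, IsGroupOrder lt ∧ ∀ x y, lt x y →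
      lt (lift (fun b => of.comp (φ b).toMonoidHom) x)
        (lift (fun b => of.comp (φ b).toMonoidHom) y) := by
  refine exists_isGroupOrder_of_ambient (IsGroupOrder.pi hlt) (MonoidHom.mulSingle G)
    (fun b => Pi.mulSingle_injective b) _ (MulEquiv.piCongrRight φ) ?_ ?_
  · rintro x y ⟨i, hi, hi'⟩
    exact ⟨i, fun j hj => congrArg (φ j) (hi j hj), hφ i _ _ hi'⟩
  · intro b g
    ext c
    exact (Pi.apply_mulSingle (fun c => φ c) (fun c => map_one (φ c)) b g c).symm

end Monoid.CoprodI

/-! ### The Artin action of a tensor product. -/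

namespace BraidGroup

variable {m n : ℕ}

theorem artin_σ (i : Fin (n - 1)) : artin n (σ i) = artinGen i :=
  PresentedGroup.toGroup.of _

theorem induction_on {p : BraidGroup n → Prop} (β : BraidGroup n) (one : p 1)
    (gen : ∀ i, p (σ i)) (inv_gen : ∀ i, p (σ i)⁻¹) (mul : ∀ α β, p α → p β → p (α * β)) : p β := by
  induction β using PresentedGroup.induction_on with
  | H z =>
    induction z using FreeGroup.induction_on with
    | C1 => exact one
    | of i => exact gen i
    | inv_of i _ => exact inv_gen i
    | mul x y hx hy => rw [map_mul]; exact mul _ _ hx hy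

/-- Intertwining of the Artin actions of the images of a braid under two homomorphisms can be checked
on generators. -/
theorem artin_intertwine {k l : ℕ} (j : BraidGroup l →* BraidGroup n)
    (j' : BraidGroup l →* BraidGroup k) (e : FreeGroup (Fin k) →* FreeGroup (Fin n))
    (h : ∀ i a, artin n (j (σ i)) (e (FreeGroup.of a)) = e (artin k (j' (σ i)) (FreeGroup.of a)))
    (β : BraidGroup l) (x : FreeGroup (Fin k)) :
    artin n (j β) (e x) = e (artin k (j' β) x) := by
  have hgen (i) (x) : artin n (j (σ i)) (e x) = e (artin k (j' (σ i)) x) :=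
    DFunLike.congr_fun (FreeGroup.ext_hom ((artin n (j (σ i))).toMonoidHom.comp e)
      (e.comp (artin k (j' (σ i))).toMonoidHom) (h i)) x
  induction β using BraidGroup.induction_on generalizing x with
  | one => simp
  | gen i => exact hgen i x
  | inv_gen i =>
    rw [map_inv, map_inv, map_inv, map_inv]
    apply (artin n (j (σ i))).injective
    rw [hgen]
    simp
  | mul α β hα hβ => simp [hα, hβ]

theorem inclLeft_σ (i : Fin (m - 1)) : inclLeft m n (σ i) = σ ⟨i, by omega⟩ :=
  PresentedGroup.toGroup.of _

theorem inclRight_σ (i : Fin (n - 1)) : inclRight m n (σ i) = σ ⟨m + i, by omega⟩ :=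
  PresentedGroup.toGroup.of _

theorem artin_inclLeft_castAdd (α : BraidGroup m) (x : FreeGroup (Fin m)) :
    artin (m + n) (inclLeft m n α) (FreeGroup.map (Fin.castAdd n) x) =
      FreeGroup.map (Fin.castAdd n) (artin m α x) := by
  refine artin_intertwine (inclLeft m n) (.id _) _ (fun i l => ?_) α x
  rw [MonoidHom.id_apply, inclLeft_σ, artin_σ, artin_σ, artinGen_of, FreeGroup.map.of, artinGen_of]
  simp only [artinFun, Fin.ext_iff, lo, hi, Fin.val_castAdd]
  split_ifs <;> simp [Fin.castAdd, Fin.castLE]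

theorem artin_inclRight_natAdd (β : BraidGroup n) (x : FreeGroup (Fin n)) :
    artin (m + n) (inclRight m n β) (FreeGroup.map (Fin.natAdd m) x) =
      FreeGroup.map (Fin.natAdd m) (artin n β x) := by
  refine artin_intertwine (inclRight m n) (.id _) _ (fun i l => ?_) β x
  rw [MonoidHom.id_apply, inclRight_σ, artin_σ, artin_σ, artinGen_of, FreeGroup.map.of, artinGen_of]
  simp only [artinFun, Fin.ext_iff, lo, hi, Fin.val_natAdd, add_assoc, Nat.add_left_cancel_iff]
  split_ifs <;> simp [Fin.natAdd]

theorem artin_inclLeft_natAdd (α : BraidGroup m) (x : FreeGroup (Fin n)) :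
    artin (m + n) (inclLeft m n α) (FreeGroup.map (Fin.natAdd m) x) =
      FreeGroup.map (Fin.natAdd m) x := by
  -- Taking the trivial homomorphism for `j'` expresses that these generators are fixed.
  simpa using artin_intertwine (inclLeft m n) 1 (FreeGroup.map (Fin.natAdd m)) (fun i l => by
    rw [inclLeft_σ, artin_σ, FreeGroup.map.of, artinGen_of, artinFun, if_neg, if_neg]
    · simp
    all_goals simp only [Fin.ext_iff, lo, hi, Fin.val_natAdd]; omega) α x

theorem artin_inclRight_castAdd (β : BraidGroup n) (x : FreeGroup (Fin m)) :
    artin (m + n) (inclRight m n β) (FreeGroup.map (Fin.castAdd n) x) =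
      FreeGroup.map (Fin.castAdd n) x := by
  simpa using artin_intertwine (inclRight m n) 1 (FreeGroup.map (Fin.castAdd n)) (fun i l => by
    rw [inclRight_σ, artin_σ, FreeGroup.map.of, artinGen_of, artinFun, if_neg, if_neg]
    · simp
    all_goals simp only [Fin.ext_iff, lo, hi, Fin.val_castAdd]; omega) β x

theorem artin_tensor_castAdd (α : BraidGroup m) (β : BraidGroup n) (x : FreeGroup (Fin m)) :
    artin (m + n) (tensor α β) (FreeGroup.map (Fin.castAdd n) x) =
      FreeGroup.map (Fin.castAdd n) (artin m α x) := by
  rw [tensor, map_mul, MulAut.mul_apply, artin_inclRight_castAdd, artin_inclLeft_castAdd]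

theorem artin_tensor_natAdd (α : BraidGroup m) (β : BraidGroup n) (x : FreeGroup (Fin n)) :
    artin (m + n) (tensor α β) (FreeGroup.map (Fin.natAdd m) x) =
      FreeGroup.map (Fin.natAdd m) (artin n β x) := by
  rw [tensor, map_mul, MulAut.mul_apply, artin_inclRight_natAdd, artin_inclLeft_natAdd]

/-- A braid whose action extends equivariantly to that of an order-preserving braid is
order-preserving. -/
theorem OrderPreserving.of_map {k : ℕ} {α : BraidGroup k} {β : BraidGroup n}
    (hβ : β.OrderPreserving) (e : FreeGroup (Fin k) →* FreeGroup (Fin n))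
    (he : Function.Injective e) (h : ∀ x, artin n β (e x) = e (artin k α x)) :
    α.OrderPreserving := by
  obtain ⟨lt, hlt, hpres⟩ := hβ
  exact ⟨_, hlt.comap e he, fun x y hxy => by simpa [h] using hpres _ _ hxy⟩

/-! ### Transport of the ordering from the free product to `𝔽_{m+n}`. -/

/-- The free groups of the two sides of a tensor product. -/
abbrev SideGroup (m n : ℕ) (b : Bool) : Type := FreeGroup (Fin (cond b n m))

/-- The free group on `m + n` generators as a free product. -/
def toCoprod (m n : ℕ) : FreeGroup (Fin (m + n)) →* Monoid.CoprodI (SideGroup m n) :=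
  FreeGroup.lift (Fin.addCases
    (fun i => Monoid.CoprodI.of (M := SideGroup m n) (i := false) (FreeGroup.of i))
    (fun i => Monoid.CoprodI.of (M := SideGroup m n) (i := true) (FreeGroup.of i)))

theorem toCoprod_castAdd (x : FreeGroup (Fin m)) :
    toCoprod m n (FreeGroup.map (Fin.castAdd n) x) =
      Monoid.CoprodI.of (M := SideGroup m n) (i := false) x :=
  DFunLike.congr_fun (FreeGroup.ext_hom ((toCoprod m n).comp (FreeGroup.map (Fin.castAdd n)))
    (Monoid.CoprodI.of (M := SideGroup m n) (i := false)) fun i => by simp [toCoprod]) x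

theorem toCoprod_natAdd (x : FreeGroup (Fin n)) :
    toCoprod m n (FreeGroup.map (Fin.natAdd m) x) =
      Monoid.CoprodI.of (M := SideGroup m n) (i := true) x :=
  DFunLike.congr_fun (FreeGroup.ext_hom ((toCoprod m n).comp (FreeGroup.map (Fin.natAdd m)))
    (Monoid.CoprodI.of (M := SideGroup m n) (i := true)) fun i => by simp [toCoprod]) x

/-- The inverse of `toCoprod`. -/
def ofCoprod (m n : ℕ) : Monoid.CoprodI (SideGroup m n) →* FreeGroup (Fin (m + n)) :=
  Monoid.CoprodI.lift fun b => match b with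
    | false => FreeGroup.map (Fin.castAdd n)
    | true => FreeGroup.map (Fin.natAdd m)

theorem toCoprod_injective : Function.Injective (toCoprod m n) := by
  have : (ofCoprod m n).comp (toCoprod m n) = MonoidHom.id _ := by
    refine FreeGroup.ext_hom _ _ fun i => ?_
    induction i using Fin.addCases <;> simp [toCoprod, ofCoprod]
  exact Function.LeftInverse.injective (DFunLike.congr_fun this)

/-- The Artin actions of two braids on the two sides of a tensor product. -/
def sideAction (α : BraidGroup m) (β : BraidGroup n) : ∀ b, MulAut (SideGroup m n b)
  | false => artin m α
  | true => artin n β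

theorem toCoprod_artin_tensor (α : BraidGroup m) (β : BraidGroup n) (x : FreeGroup (Fin (m + n))) :
    toCoprod m n (artin (m + n) (tensor α β) x) =
      Monoid.CoprodI.lift (fun b => Monoid.CoprodI.of.comp (sideAction α β b).toMonoidHom)
        (toCoprod m n x) := by
  refine DFunLike.congr_fun (FreeGroup.ext_hom
    ((toCoprod m n).comp (artin (m + n) (tensor α β)).toMonoidHom)
    ((Monoid.CoprodI.lift fun b => Monoid.CoprodI.of.comp (sideAction α β b).toMonoidHom).comp
      (toCoprod m n)) fun i => ?_) x
  simp only [MonoidHom.comp_apply, MulEquiv.toMonoidHom_eq_coe, MonoidHom.coe_coe]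
  induction i using Fin.addCases with
  | left i =>
    rw [← FreeGroup.map.of (f := Fin.castAdd n), artin_tensor_castAdd, toCoprod_castAdd,
      toCoprod_castAdd, Monoid.CoprodI.lift_of]
    rfl
  | right i =>
    rw [← FreeGroup.map.of (f := Fin.natAdd m), artin_tensor_natAdd, toCoprod_natAdd,
      toCoprod_natAdd, Monoid.CoprodI.lift_of]
    rfl

theorem OrderPreserving.tensor {α : BraidGroup m} {β : BraidGroup n} (hα : α.OrderPreserving)
    (hβ : β.OrderPreserving) : (tensor α β).OrderPreserving := by
  obtain ⟨ltα, hα, hα'⟩ := hα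
  obtain ⟨ltβ, hβ, hβ'⟩ := hβ
  obtain ⟨lt, hlt, hpres⟩ := Monoid.CoprodI.exists_isGroupOrder (G := SideGroup m n)
    (lt := fun b => match b with
      | false => ltα
      | true => ltβ)
    (fun b => match b with
      | false => hα
      | true => hβ)
    (sideAction α β)
    (fun b => match b with
      | false => hα'
      | true => hβ')
  refine ⟨_, hlt.comap (toCoprod m n) toCoprod_injective, fun x y hxy => ?_⟩
  rw [toCoprod_artin_tensor, toCoprod_artin_tensor]
  exact hpres _ _ hxy

end BraidGroup

theorem mainTheorem5 (m n : ℕ) (α : BraidGroup m) (β : BraidGroup n) :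
    (BraidGroup.tensor α β).OrderPreserving ↔ α.OrderPreserving ∧ β.OrderPreserving :=
  ⟨fun h => ⟨h.of_map _ (FreeGroup.map_injective (Fin.castAdd_injective m n))
      (BraidGroup.artin_tensor_castAdd α β),
    h.of_map _ (FreeGroup.map_injective (Fin.natAdd_injective n m))
      (BraidGroup.artin_tensor_natAdd α β)⟩,
    fun h => h.1.tensor h.2⟩
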